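/- **Setting.** Let $(\mathcal A;\mathcal E)$ be an exact category: $\mathcal A$ is an additive category and $\mathcal E$ is an exact structure on it in the sense of Quillen, whose distinguished kernel-cokernel pairs $A\to B\to C$ are called conflations; the second morphism of a conflation is called a deflation. An ideal of $\mathcal A$ is an additive subbifunctor of $\mathrm{Hom}$, and $\langle\mathcal M\rangle$ denotes the smallest ideal containing a class $\mathcal M$ of morphisms. The product of two ideals is $\mathcal I\mathcal J=\langle ij \mid i\in\mathcal I,\ j\in\mathcal J \text{ composable}\rangle$. Subcategories are full. A conflation of arrows $\xi: i\to a\to j$ (with $i:I_0\to I_1$, $a:A_0\to A_1$, $j:J_0\to J_1$) is a morphism $(i,a,j)$ from a conflation $I_0\to A_0\xrightarrow{e_0} J_0$ to a conflation $I_1\xrightarrow{m_1}A_1\to J_1$. It is mono-epi (ME) if it factors as $(i,a^2,1_{J_1})\circ(1_{I_0},a^1,j)$ through some conflation $I_0\to M\to J_1$. It is null-homotopic if $a=m_1h+ge_0$ for some $h:A_0\to I_1$ and $g:J_0\to A_1$. We write $a=i\star j$ if there is an ME-conflation $i\to a\to j$, and, for objects, $Z=X\star Y$ if there is a conflation $X\to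 Z\to Y$. For subcategories, $\mathcal X\star\mathcal Y$ is the subcategory of all objects $X\star Y$ with $X\in\mathcal X$, $Y\in\mathcal Y$. For ideals, $\mathcal I\diamond\mathcal J=\langle i\star j\mid i\in\mathcal I,\ j\in\mathcal J\rangle$. Finally, $\mathcal I^\perp$ consists of the morphisms $k$ such that, for every $i\in\mathcal I$, every ME-conflation $k\to a\to i$ is null-homotopic. A special $\mathcal I$-precover of an object $A$, with $\mathcal I$-syzygy $k$, is a morphism $i_1:C_1\to A$ in $\mathcal I$ that is the deflation of the lower row of a conflation of arrows $k\to c\to 1_A$ with $k\in\mathcal I^\perp$. It is object-special if $k$ can be chosen to be an isomorphism; the kernel of $i_1$ is then called an object $\mathcal I$-syzygy of $A$. The ideal $\mathcal I$ is (object-)special precovering if every object of $\mathcal A$ has an (object-)special $\mathcal I$-precover. An $\mathcal I$-syzygy ideal is an ideal contained in $\mathcal I^\perp$ that contains an $\mathcal I$-syzygy of every object. An $\mathcal I$-syzygy subcategory is a subcategory $\mathcal C$ closed under finite direct sums such that the ideal $\langle 1_X\mid X\in\mathcal C\rangle$ is an $\mathcal I$-syzygy ideal. **Theorem.** Let $\mathcal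 I$ and $\mathcal J$ be ideals of $\mathcal A$. 1. (The Chain Rule) If $i:C\to A$ is a special $\mathcal I$-precover with $\mathcal I$-syzygy $\omega_{\mathcal I}$ and $j:D\to C$ is a special $\mathcal J$-precover with $\mathcal J$-syzygy $\omega_{\mathcal J}$, then $ij:D\to A$ is a special $\mathcal I\mathcal J$-precover of $A$ with an $\mathcal I\mathcal J$-syzygy of the form $\omega_{\mathcal J}\star\omega_{\mathcal I}$. 2. If moreover $i$ and $j$ are object-special, with kernels $\Omega_{\mathcal I}$ and $\Omega_{\mathcal J}$ respectively, then $ij$ is an object-special $\mathcal I\mathcal J$-precover of $A$ whose kernel is of the form $\Omega_{\mathcal J}\star\Omega_{\mathcal I}$. 3. If $\mathcal I$ and $\mathcal J$ are special precovering ideals, then so is $\mathcal I\mathcal J$; and if $\omega(\mathcal I)$ is an $\mathcal I$-syzygy ideal and $\omega(\mathcal J)$ a $\mathcal J$-syzygy ideal, then $\omega(\mathcal J)\diamond\omega(\mathcal I)$ is an $\mathcal I\mathcal J$-syzygy ideal. 4. If $\mathcal I$ and $\mathcal J$ are object-special precovering ideals, then so is $\mathcal I\mathcal J$; and if $\Omega(\mathcal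 I)$ is an $\mathcal I$-syzygy subcategory and $\Omega(\mathcal J)$ a $\mathcal J$-syzygy subcategory, then $\Omega(\mathcal J)\star\Omega(\mathcal I)$ is an $\mathcal I\mathcal J$-syzygy subcategory. -/

import Mathlib

open CategoryTheory CategoryTheory.Limits

universe v u

namespace IdealApprox

section Ideals

variable {A : Type u} [Category.{v} A] [Preadditive A]

/-- An ideal of a preadditive category: an additive subbifunctor of `Hom`. -/
structure MorIdeal (A : Type u) [Category.{v} A] [Preadditive A] where
  /-- the subgroup `I (X, Y)` of `Hom (X, Y)` -/
  hom (X Y : A) : AddSubgroup (X ⟶ Y)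
  comp_mem {W X Y Z : A} (h : W ⟶ X) (g : X ⟶ Y) (f : Y ⟶ Z) :
    g ∈ hom X Y → h ≫ g ≫ f ∈ hom W Z

/-- The class of morphisms belonging to an ideal. -/
def MorIdeal.mor (I : MorIdeal A) : MorphismProperty A := fun X Y f => f ∈ I.hom X Y

/-- The smallest ideal `⟨M⟩` containing a class `M` of morphisms. -/
def MorIdeal.span (M : MorphismProperty A) : MorIdeal A where
  hom X Y := ⨅ I : {I : MorIdeal A // M ≤ I.mor}, I.1.hom X Y
  comp_mem h g f hg := by
    rw [AddSubgroup.mem_iInf] at hg ⊢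
    exact fun I => I.1.comp_mem h g f (hg I)

/-- The class of composites `i ∘ j` with `i ∈ I` and `j ∈ J`. -/
def MorIdeal.composites (I J : MorIdeal A) : MorphismProperty A := fun X Z f =>
  ∃ (Y : A) (j : X ⟶ Y) (i : Y ⟶ Z), J.mor j ∧ I.mor i ∧ j ≫ i = f

/-- The product ideal `IJ`, generated by the composites `i ∘ j`, `i ∈ I`, `j ∈ J`. -/
def MorIdeal.prod (I J : MorIdeal A) : MorIdeal A := MorIdeal.span (I.composites J)

/-- The class of identity morphisms of the objects of a (full) subcategory. -/
def identities (P : ObjectProperty A) : MorphismProperty A := fun X Y f =>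
  P X ∧ ∃ h : X = Y, f = eqToHom h

/-- The object ideal generated by a (full) subcategory. -/
def objIdeal (P : ObjectProperty A) : MorIdeal A := MorIdeal.span (identities P)

end Ideals

/-- `X ⟶ Y ⟶ Z` is a kernel-cokernel pair. -/
def IsKernelCokernelPair {A : Type u} [Category.{v} A] [Preadditive A] {X Y Z : A}
    (m : X ⟶ Y) (e : Y ⟶ Z) : Prop :=
  ∃ w : m ≫ e = 0, Nonempty (IsLimit (KernelFork.ofι m w)) ∧
    Nonempty (IsColimit (CokernelCofork.ofπ e w))

/-- An exact structure (in the sense of Quillen) on an additive category. -/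
structure ExactStr (A : Type u) [Category.{v} A] [Preadditive A] where
  /-- the distinguished kernel-cokernel pairs -/
  conf {X Y Z : A} (m : X ⟶ Y) (e : Y ⟶ Z) : Prop
  pair {X Y Z : A} {m : X ⟶ Y} {e : Y ⟶ Z} : conf m e → IsKernelCokernelPair m e
  of_iso {X Y Z X' Y' Z' : A} {m : X ⟶ Y} {e : Y ⟶ Z} {m' : X' ⟶ Y'} {e' : Y' ⟶ Z'}
    (α : X ≅ X') (β : Y ≅ Y') (γ : Z ≅ Z') :
    m ≫ β.hom = α.hom ≫ m' → e ≫ γ.hom = β.hom ≫ e' → conf m e → conf m' e'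
  id_inflation (X : A) : ∃ (Z : A) (e : X ⟶ Z), conf (𝟙 X) e
  id_deflation (X : A) : ∃ (K : A) (m : K ⟶ X), conf m (𝟙 X)
  inflation_comp {X Y Z C D : A} {m : X ⟶ Y} {n : Y ⟶ Z} {e : Y ⟶ C} {f : Z ⟶ D} :
    conf m e → conf n f → ∃ (B : A) (g : Z ⟶ B), conf (m ≫ n) g
  deflation_comp {X Y Z K L : A} {e : X ⟶ Y} {f : Y ⟶ Z} {m : K ⟶ X} {n : L ⟶ Y} :
    conf m e → conf n f → ∃ (M : A) (g : M ⟶ X), conf g (e ≫ f)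
  pushout_inflation {X Y Z X' : A} {m : X ⟶ Y} {e : Y ⟶ Z} (f : X ⟶ X') : conf m e →
    ∃ (Y' : A) (m' : X' ⟶ Y') (f' : Y ⟶ Y'), IsPushout m f f' m' ∧
      ∃ (Z' : A) (e' : Y' ⟶ Z'), conf m' e'
  pullback_deflation {X Y Z Z' : A} {m : X ⟶ Y} {e : Y ⟶ Z} (f : Z' ⟶ Z) : conf m e →
    ∃ (Y' : A) (e' : Y' ⟶ Z') (f' : Y' ⟶ Y), IsPullback f' e' e f ∧
      ∃ (X' : A) (m' : X' ⟶ Y'), conf m' e'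

section Exact

variable {A : Type u} [Category.{v} A] [Preadditive A] (E : ExactStr A)

/-- A conflation `i ⟶ a ⟶ j` of arrows for the exact structure `Arr(E)`, that is, a morphism
`(i, a, j)` from a conflation `I₀ ⟶ A₀ ⟶ J₀` to a conflation `I₁ ⟶ A₁ ⟶ J₁`. -/
structure ArrConf {I₀ I₁ A₀ A₁ J₀ J₁ : A} (i : I₀ ⟶ I₁) (a : A₀ ⟶ A₁) (j : J₀ ⟶ J₁) where
  m₀ : I₀ ⟶ A₀
  e₀ : A₀ ⟶ J₀
  m₁ : I₁ ⟶ A₁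
  e₁ : A₁ ⟶ J₁
  conf₀ : E.conf m₀ e₀
  conf₁ : E.conf m₁ e₁
  comm_m : m₀ ≫ a = i ≫ m₁
  comm_e : e₀ ≫ j = a ≫ e₁

variable {E}

/-- The conflation `i ⟶ a ⟶ j` of arrows is mono-epi (ME): it factors, as a morphism of
conflations, through a conflation `I₀ ⟶ M ⟶ J₁` by morphisms of the form
`(1, a¹, j)` and `(i, a², 1)`. -/
def ArrConf.IsME {I₀ I₁ A₀ A₁ J₀ J₁ : A} {i : I₀ ⟶ I₁} {a : A₀ ⟶ A₁} {j : J₀ ⟶ J₁}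
    (ξ : ArrConf E i a j) : Prop :=
  ∃ (M : A) (m : I₀ ⟶ M) (e : M ⟶ J₁) (a1 : A₀ ⟶ M) (a2 : M ⟶ A₁),
    E.conf m e ∧ a1 ≫ a2 = a ∧
    ξ.m₀ ≫ a1 = m ∧ ξ.e₀ ≫ j = a1 ≫ e ∧
    m ≫ a2 = i ≫ ξ.m₁ ∧ e = a2 ≫ ξ.e₁

/-- The conflation of arrows is null-homotopic. -/
def ArrConf.IsNullHomotopic {I₀ I₁ A₀ A₁ J₀ J₁ : A} {i : I₀ ⟶ I₁} {a : A₀ ⟶ A₁}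
    {j : J₀ ⟶ J₁} (ξ : ArrConf E i a j) : Prop :=
  ∃ (h : A₀ ⟶ I₁) (g : J₀ ⟶ A₁), a = h ≫ ξ.m₁ + ξ.e₀ ≫ g

variable (E)

/-- `a = i ⋆ j`: the arrow `a` is an extension of `j` by `i`, i.e. there is an ME-conflation
`i ⟶ a ⟶ j`. -/
def IsStar {I₀ I₁ A₀ A₁ J₀ J₁ : A} (i : I₀ ⟶ I₁) (a : A₀ ⟶ A₁) (j : J₀ ⟶ J₁) : Prop :=
  ∃ ξ : ArrConf E i a j, ξ.IsME

/-- `Z = X ⋆ Y` for objects: there is a conflation `X ⟶ Z ⟶ Y`. -/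
def IsObjStar (X Z Y : A) : Prop := ∃ (m : X ⟶ Z) (e : Z ⟶ Y), E.conf m e

/-- The class `M ⋆ N` of all extensions `i ⋆ j` with `i ∈ M` and `j ∈ N`. -/
def starMor (M N : MorphismProperty A) : MorphismProperty A := fun _ _ a =>
  ∃ (I₀ I₁ J₀ J₁ : A) (i : I₀ ⟶ I₁) (j : J₀ ⟶ J₁), M i ∧ N j ∧ IsStar E i a j

/-- The extension ideal `I ◇ J`, generated by the extensions `i ⋆ j`, `i ∈ I`, `j ∈ J`. -/
def diamond (I J : MorIdeal A) : MorIdeal A := MorIdeal.span (starMor E I.mor J.mor)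

/-- The subcategory `P ⋆ Q` of all extensions `X ⋆ Y` with `X ∈ P` and `Y ∈ Q`. -/
def starObj (P Q : ObjectProperty A) : ObjectProperty A := fun Z =>
  ∃ X Y : A, P X ∧ Q Y ∧ IsObjStar E X Z Y

/-- `Ext (j, i) = 0`: every ME-conflation `i ⟶ a ⟶ j` is null-homotopic. -/
def ExtOrth {J₀ J₁ I₀ I₁ : A} (j : J₀ ⟶ J₁) (i : I₀ ⟶ I₁) : Prop :=
  ∀ (A₀ A₁ : A) (a : A₀ ⟶ A₁) (ξ : ArrConf E i a j), ξ.IsME → ξ.IsNullHomotopic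

/-- The morphisms `k` of the right perpendicular `I^⊥`: `Ext (i, k) = 0` for all `i ∈ I`. -/
def rightPerp (I : MorIdeal A) : MorphismProperty A := fun _ _ k =>
  ∀ (X Y : A) (i : X ⟶ Y), I.mor i → ExtOrth E i k

/-- `i₁ : C₁ ⟶ X` is a special `I`-precover of `X` with `I`-syzygy `k`: the morphism `i₁` lies
in `I`, the morphism `k` lies in `I^⊥`, and `i₁` is the deflation of the lower row of a conflation
of arrows `k ⟶ c ⟶ 1_X` (the left hand square of which is then a pushout). -/
def IsSpecialPrecoverWith (I : MorIdeal A) {C₁ X : A} (i₁ : C₁ ⟶ X) {K₀ K₁ : A}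
    (k : K₀ ⟶ K₁) : Prop :=
  I.mor i₁ ∧ rightPerp E I k ∧
    ∃ (C₀ : A) (c : C₀ ⟶ C₁) (ξ : ArrConf E k c (𝟙 X)), ξ.e₁ = i₁

/-- `i₁` is a special `I`-precover. -/
def IsSpecialPrecover (I : MorIdeal A) {C₁ X : A} (i₁ : C₁ ⟶ X) : Prop :=
  ∃ (K₀ K₁ : A) (k : K₀ ⟶ K₁), IsSpecialPrecoverWith E I i₁ k

/-- `i₁` is an object-special `I`-precover: it has an `I`-syzygy that is an isomorphism. -/
def IsObjSpecialPrecover (I : MorIdeal A) {C₁ X : A} (i₁ : C₁ ⟶ X) : Prop :=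
  ∃ (K₀ K₁ : A) (k : K₀ ⟶ K₁), IsIso k ∧ IsSpecialPrecoverWith E I i₁ k

/-- `i₁` is an object-special `I`-precover with kernel (object `I`-syzygy) `Ω`. -/
def IsObjSpecialPrecoverWith (I : MorIdeal A) {C₁ X : A} (i₁ : C₁ ⟶ X) (Ω : A) : Prop :=
  IsObjSpecialPrecover E I i₁ ∧ ∃ m : Ω ⟶ C₁, E.conf m i₁

/-- Every object has a special `I`-precover. -/
def IsSpecialPrecovering (I : MorIdeal A) : Prop :=
  ∀ X : A, ∃ (C : A) (i : C ⟶ X), IsSpecialPrecover E I i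

/-- Every object has an object-special `I`-precover. -/
def IsObjSpecialPrecovering (I : MorIdeal A) : Prop :=
  ∀ X : A, ∃ (C : A) (i : C ⟶ X), IsObjSpecialPrecover E I i

/-- `W` is an `I`-syzygy ideal: it is contained in `I^⊥` and contains an `I`-syzygy of every
object. -/
def IsSyzygyIdeal (I W : MorIdeal A) : Prop :=
  W.mor ≤ rightPerp E I ∧
    ∀ X : A, ∃ (C : A) (i : C ⟶ X) (K₀ K₁ : A) (k : K₀ ⟶ K₁),
      IsSpecialPrecoverWith E I i k ∧ W.mor k

/-- `P` is an `I`-syzygy subcategory: it is closed under finite direct sums (which are the finite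
products of an additive category) and the ideal it generates is an `I`-syzygy ideal. -/
def IsSyzygySubcat (I : MorIdeal A) (P : ObjectProperty A) : Prop :=
  P.IsClosedUnderFiniteProducts ∧ IsSyzygyIdeal E I (objIdeal P)

end Exact

end IdealApprox

/-!
Sending a conflation `W₀ ⟶ M ⟶ Y₁` to its pushout along `w : W₀ ⟶ W₁` pulled back along
`f : Y₀ ⟶ Y₁` defines a map `Ext (Y₁, W₀) ⟶ Ext (Y₀, W₁)`, and `Ext (f, w) = 0` says that this map
vanishes. Equivalently, `f` always lifts to the pushout, or `w` always extends to the pullback.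
The first form is additive and functorial in `f`, the second one in `w`.

The chain rule rests on a diagram chase of the type of the long exact sequence. If `w = l ⋆ k`, then
`w` factors as `W₀ ⟶ N ⟶ W₁` through the middle term of a conflation `L₀ ⟶ N ⟶ K₁` for which
`W₀ ⟶ N ⟶ K₁` factors through `k`. Given a class of `Ext (Y, W₀)`, pull its image in `Ext (Y, N)`
back along `i : Z ⟶ Y`. Since `Ext (i, k) = 0`, the result dies in `Ext (Z, K₁)`, so it comes from
`Ext (Z, L₀)`, and `Ext (j, l) = 0` finishes the argument: `Ext (ij, l ⋆ k) = 0`. The syzygy of `ij`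
is such a star, since the kernel of a composite of two deflations of arrows is an extension of their
kernels.
-/

namespace IdealApprox

namespace MorIdeal

variable {A : Type u} [Category.{v} A] [Preadditive A] {I J : MorIdeal A} {X Y Z : A}

lemma precomp (g : X ⟶ Y) {f : Y ⟶ Z} (hf : I.mor f) : I.mor (g ≫ f) := by
  have h := I.comp_mem g f (𝟙 Z) hf
  rwa [Category.comp_id] at h

lemma span_le_iff {M : MorphismProperty A} : (span M).mor ≤ I.mor ↔ M ≤ I.mor := by
  refine ⟨fun h X Y f hf => h f ?_, fun h X Y f hf => ?_⟩
  · exact AddSubgroup.mem_iInf.2 fun K => K.2 f hf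
  · exact AddSubgroup.mem_iInf.1 hf ⟨I, h⟩

lemma le_span (M : MorphismProperty A) : M ≤ (span M).mor := span_le_iff.1 le_rfl

lemma comp_mem_prod {j : X ⟶ Y} {i : Y ⟶ Z} (hj : J.mor j) (hi : I.mor i) :
    (I.prod J).mor (j ≫ i) :=
  le_span _ _ ⟨Y, j, i, hj, hi, rfl⟩

lemma objIdeal_le_iff {P : ObjectProperty A} :
    (objIdeal P).mor ≤ I.mor ↔ ∀ X, P X → I.mor (𝟙 X) := by
  refine span_le_iff.trans ⟨fun h X hX => h _ ⟨hX, rfl, rfl⟩, ?_⟩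
  rintro h X _ _ ⟨hX, rfl, rfl⟩
  exact h X hX

end MorIdeal

section Conflations

variable {A : Type u} [Category.{v} A] [Preadditive A] {E : ExactStr A}

namespace ExactStr

variable {X Y Z : A} {m : X ⟶ Y} {e : Y ⟶ Z}

lemma conf.w (h : E.conf m e) : m ≫ e = 0 := (E.pair h).1

lemma conf.exists_lift (h : E.conf m e) {T : A} (f : T ⟶ Y) (hf : f ≫ e = 0) :
    ∃ g, g ≫ m = f := by
  obtain ⟨w, ⟨hl⟩, -⟩ := E.pair h
  exact ⟨_, (KernelFork.IsLimit.lift' hl f hf).2⟩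

lemma conf.exists_desc (h : E.conf m e) {T : A} (f : Y ⟶ T) (hf : m ≫ f = 0) :
    ∃ g, e ≫ g = f := by
  obtain ⟨w, -, ⟨hc⟩⟩ := E.pair h
  exact ⟨_, (CokernelCofork.IsColimit.desc' hc f hf).2⟩

lemma conf.mono (h : E.conf m e) : Mono m := by
  obtain ⟨w, ⟨hl⟩, -⟩ := E.pair h
  exact Fork.IsLimit.mono hl

lemma conf.epi (h : E.conf m e) : Epi e := by
  obtain ⟨w, -, ⟨hc⟩⟩ := E.pair h
  exact Cofork.IsColimit.epi hc

lemma conf.of_cokernel (h : E.conf m e) {Z' : A} (e' : Y ⟶ Z') [Epi e'] (w : m ≫ e' = 0)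
    (hd : ∀ {T : A} (f : Y ⟶ T), m ≫ f = 0 → ∃ g, e' ≫ g = f) : E.conf m e' := by
  obtain ⟨p, hp⟩ := h.exists_desc e' w
  obtain ⟨q, hq⟩ := hd e h.w
  have := h.epi
  refine E.of_iso (Iso.refl _) (Iso.refl _) ⟨p, q, ?_, ?_⟩ (by simp) (by simpa using hp) h
  · rw [← cancel_epi e, reassoc_of% hp, hq, Category.comp_id]
  · rw [← cancel_epi e', reassoc_of% hq, hp, Category.comp_id]

lemma conf.of_kernel (h : E.conf m e) {X' : A} (m' : X' ⟶ Y) [Mono m'] (w : m' ≫ e = 0)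
    (hl : ∀ {T : A} (f : T ⟶ Y), f ≫ e = 0 → ∃ g, g ≫ m' = f) : E.conf m' e := by
  obtain ⟨p, hp⟩ := h.exists_lift m' w
  obtain ⟨q, hq⟩ := hl m h.w
  have := h.mono
  refine E.of_iso ⟨q, p, ?_, ?_⟩ (Iso.refl _) (Iso.refl _) (by simpa using hq.symm) (by simp) h
  · rw [← cancel_mono m, Category.assoc, hp, hq, Category.id_comp]
  · rw [← cancel_mono m', Category.assoc, hq, hp, Category.id_comp]

lemma conf_id_zero (X : A) (hZ : IsZero Z) : E.conf (𝟙 X) (0 : X ⟶ Z) := by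
  obtain ⟨_, e, h⟩ := E.id_inflation X
  have : Epi (0 : X ⟶ Z) := ⟨fun _ _ _ => hZ.eq_of_src _ _⟩
  exact h.of_cokernel 0 comp_zero fun f hf => ⟨0, by rw [comp_zero, ← hf, Category.id_comp]⟩

lemma conf.of_isPushout (h : E.conf m e) {X' Y' : A} {f : X ⟶ X'} {f' : Y ⟶ Y'} {m' : X' ⟶ Y'}
    (sq : IsPushout m f f' m') {e' : Y' ⟶ Z} (he : f' ≫ e' = e) (hm : m' ≫ e' = 0) :
    E.conf m' e' := by
  obtain ⟨Y'', m'', f'', sq', Z'', e'', h''⟩ := E.pushout_inflation f h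
  have hm' : E.conf m' ((sq.isoIsPushout _ _ sq').hom ≫ e'') :=
    E.of_iso (Iso.refl _) (sq.isoIsPushout _ _ sq').symm (Iso.refl _) (by simp) (by simp) h''
  have := h.epi
  have : Epi e' := epi_of_epi_fac he
  refine hm'.of_cokernel e' hm fun g hg => ?_
  obtain ⟨t, ht⟩ := h.exists_desc (f' ≫ g) (by rw [reassoc_of% sq.w, hg, comp_zero])
  exact ⟨t, sq.hom_ext (by rw [reassoc_of% he, ht]) (by rw [reassoc_of% hm, hg, zero_comp])⟩

lemma conf.of_isPullback (h : E.conf m e) {Z' Y' : A} {f : Z' ⟶ Z} {f' : Y' ⟶ Y} {e' : Y' ⟶ Z'}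
    (sq : IsPullback f' e' e f) {m' : X ⟶ Y'} (hm : m' ≫ f' = m) (he : m' ≫ e' = 0) :
    E.conf m' e' := by
  obtain ⟨Y'', e'', f'', sq', X'', m'', h''⟩ := E.pullback_deflation f h
  have he' : E.conf (m'' ≫ (sq.isoIsPullback _ _ sq').inv) e' :=
    E.of_iso (Iso.refl _) (sq.isoIsPullback _ _ sq').symm (Iso.refl _) (by simp) (by simp) h''
  have := h.mono
  have : Mono m' := mono_of_mono_fac hm
  refine he'.of_kernel m' he fun g hg => ?_
  obtain ⟨t, ht⟩ := h.exists_lift (g ≫ f')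
    (by rw [Category.assoc, sq.w, reassoc_of% hg, zero_comp])
  exact ⟨t, sq.hom_ext (by rw [Category.assoc, hm, ht]) (by rw [Category.assoc, he, hg, comp_zero])⟩

lemma conf.exists_pushout (h : E.conf m e) {X' : A} (f : X ⟶ X') :
    ∃ (Y' : A) (m' : X' ⟶ Y') (f' : Y ⟶ Y') (e' : Y' ⟶ Z),
      IsPushout m f f' m' ∧ E.conf m' e' ∧ f' ≫ e' = e := by
  obtain ⟨Y', m', f', sq, -⟩ := E.pushout_inflation f h
  have w : m ≫ e = f ≫ 0 := by rw [h.w, comp_zero]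
  exact ⟨Y', m', f', sq.desc e 0 w, sq,
    h.of_isPushout sq (sq.inl_desc _ _ _) (sq.inr_desc _ _ _), sq.inl_desc _ _ _⟩

lemma conf.exists_pullback (h : E.conf m e) {Z' : A} (f : Z' ⟶ Z) :
    ∃ (Y' : A) (m' : X ⟶ Y') (f' : Y' ⟶ Y) (e' : Y' ⟶ Z'),
      IsPullback f' e' e f ∧ E.conf m' e' ∧ m' ≫ f' = m := by
  obtain ⟨Y', e', f', sq, -⟩ := E.pullback_deflation f h
  have w : m ≫ e = 0 ≫ f := by rw [h.w, zero_comp]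
  exact ⟨Y', sq.lift m 0 w, f', e', sq,
    h.of_isPullback sq (sq.lift_fst _ _ _) (sq.lift_snd _ _ _), sq.lift_fst _ _ _⟩

lemma conf.comp_of_isPushout (h : E.conf m e) {Y' Z' P : A} {n : Y ⟶ Y'} {q : Y' ⟶ Z'}
    (h' : E.conf n q) {p : Y' ⟶ P} {κ : Z ⟶ P} (sq : IsPushout n e p κ) :
    E.conf (m ≫ n) p := by
  obtain ⟨B, g, hB⟩ := E.inflation_comp h h'
  have := h.epi
  have : Epi p := ⟨fun a b hab => sq.hom_ext hab <| by
    rw [← cancel_epi e, ← reassoc_of% sq.w, hab, reassoc_of% sq.w]⟩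
  refine hB.of_cokernel p ?_ fun f hf => ?_
  · rw [Category.assoc, sq.w, reassoc_of% h.w, zero_comp]
  · obtain ⟨t, ht⟩ := h.exists_desc (n ≫ f) (by rw [← Category.assoc, hf])
    exact ⟨sq.desc f t ht.symm, sq.inl_desc _ _ _⟩

lemma conf.comp_of_isPullback (h : E.conf m e) {X' Y' P : A} {n : X' ⟶ Y'} {q : Y' ⟶ Y}
    (h' : E.conf n q) {p : P ⟶ Y'} {κ : P ⟶ X} (sq : IsPullback p κ q m) :
    E.conf p (q ≫ e) := by
  obtain ⟨B, g, hB⟩ := E.deflation_comp h' h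
  have := h.mono
  have : Mono p := ⟨fun a b hab => sq.hom_ext hab <| by
    rw [← cancel_mono m, Category.assoc, ← sq.w, Category.assoc, ← sq.w, reassoc_of% hab]⟩
  refine hB.of_kernel p ?_ fun f hf => ?_
  · rw [reassoc_of% sq.w, h.w, comp_zero]
  · obtain ⟨t, ht⟩ := h.exists_lift (f ≫ q) (by rw [Category.assoc, hf])
    exact ⟨sq.lift f t ht.symm, sq.lift_fst _ _ _⟩

end ExactStr

namespace ArrConf

variable {I₀ I₁ A₀ A₁ J₀ J₁ : A} {i : I₀ ⟶ I₁} {a : A₀ ⟶ A₁} {j : J₀ ⟶ J₁}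

lemma isNullHomotopic_iff_exists_lift (ξ : ArrConf E i a j) :
    ξ.IsNullHomotopic ↔ ∃ t : J₀ ⟶ A₁, t ≫ ξ.e₁ = j := by
  constructor
  · rintro ⟨h, g, hg⟩
    have := ξ.conf₀.epi
    refine ⟨g, ?_⟩
    rw [← cancel_epi ξ.e₀, ξ.comm_e, hg =≫ ξ.e₁, Preadditive.add_comp, Category.assoc, ξ.conf₁.w,
      comp_zero, zero_add, Category.assoc]
  · rintro ⟨t, ht⟩
    obtain ⟨h, hh⟩ := ξ.conf₁.exists_lift (a - ξ.e₀ ≫ t) (by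
      rw [Preadditive.sub_comp, Category.assoc, ht, ξ.comm_e, sub_self])
    exact ⟨h, t, by rw [hh, sub_add_cancel]⟩

lemma isNullHomotopic_iff_exists_extension (ξ : ArrConf E i a j) :
    ξ.IsNullHomotopic ↔ ∃ s : A₀ ⟶ I₁, ξ.m₀ ≫ s = i := by
  constructor
  · rintro ⟨h, g, hg⟩
    have := ξ.conf₁.mono
    refine ⟨h, ?_⟩
    rw [← cancel_mono ξ.m₁, ← ξ.comm_m, ξ.m₀ ≫= hg, Preadditive.comp_add, reassoc_of% ξ.conf₀.w,
      zero_comp, add_zero, Category.assoc]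
  · rintro ⟨s, hs⟩
    obtain ⟨g, hg⟩ := ξ.conf₀.exists_desc (a - s ≫ ξ.m₁) (by
      rw [Preadditive.comp_sub, reassoc_of% hs, ξ.comm_m, sub_self])
    exact ⟨s, g, by rw [hg, add_sub_cancel]⟩

lemma isME_of_right_id {J : A} (ξ : ArrConf E i a (𝟙 J)) : ξ.IsME :=
  ⟨A₀, ξ.m₀, ξ.e₀, 𝟙 A₀, a, ξ.conf₀, Category.id_comp _, Category.comp_id _, by simp, ξ.comm_m,
    by simpa only [Category.comp_id] using ξ.comm_e⟩

/-- The identity morphism of a conflation, as a conflation of arrows. -/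
def id {X Y Z : A} {m : X ⟶ Y} {e : Y ⟶ Z} (h : E.conf m e) : ArrConf E (𝟙 X) (𝟙 Y) (𝟙 Z) where
  m₀ := m
  e₀ := e
  m₁ := m
  e₁ := e
  conf₀ := h
  conf₁ := h
  comm_m := by simp
  comm_e := by simp

/-- The pullback of a conflation of arrows `i ⟶ a ⟶ j` along a morphism of arrows
`(g₀, g₁) : k ⟶ j`, for given pullback squares on the domains and on the codomains. -/
noncomputable def pullback (ξ : ArrConf E i a j) {K₀ K₁ W₀ W₁ : A} {k : K₀ ⟶ K₁}
    {g₀ : K₀ ⟶ J₀} {g₁ : K₁ ⟶ J₁} {f₀ : W₀ ⟶ A₀} {f₁ : W₁ ⟶ A₁} {p₀ : W₀ ⟶ K₀} {p₁ : W₁ ⟶ K₁}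
    (sq₀ : IsPullback f₀ p₀ ξ.e₀ g₀) (sq₁ : IsPullback f₁ p₁ ξ.e₁ g₁) {w : W₀ ⟶ W₁}
    (hf : f₀ ≫ a = w ≫ f₁) (hp : p₀ ≫ k = w ≫ p₁) : ArrConf E i w k where
  m₀ := sq₀.lift ξ.m₀ 0 (by rw [ξ.conf₀.w, zero_comp])
  e₀ := p₀
  m₁ := sq₁.lift ξ.m₁ 0 (by rw [ξ.conf₁.w, zero_comp])
  e₁ := p₁
  conf₀ := ξ.conf₀.of_isPullback sq₀ (sq₀.lift_fst _ _ _) (sq₀.lift_snd _ _ _)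
  conf₁ := ξ.conf₁.of_isPullback sq₁ (sq₁.lift_fst _ _ _) (sq₁.lift_snd _ _ _)
  comm_m := sq₁.hom_ext (by simp [← hf, ξ.comm_m]) (by simp [← hp])
  comm_e := hp

lemma IsME.pullback {ξ : ArrConf E i a j} (hξ : ξ.IsME) {K₀ K₁ W₀ W₁ : A} {k : K₀ ⟶ K₁}
    {g₀ : K₀ ⟶ J₀} {g₁ : K₁ ⟶ J₁} {f₀ : W₀ ⟶ A₀} {f₁ : W₁ ⟶ A₁} {p₀ : W₀ ⟶ K₀} {p₁ : W₁ ⟶ K₁}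
    (sq₀ : IsPullback f₀ p₀ ξ.e₀ g₀) (sq₁ : IsPullback f₁ p₁ ξ.e₁ g₁) (hg : g₀ ≫ j = k ≫ g₁)
    {w : W₀ ⟶ W₁} (hf : f₀ ≫ a = w ≫ f₁) (hp : p₀ ≫ k = w ≫ p₁) :
    (ξ.pullback sq₀ sq₁ hf hp).IsME := by
  obtain ⟨M, m, e, a1, a2, hM, ha, hm₀, he₀, hm₁, he₁⟩ := hξ
  obtain ⟨N, n, f, q, sqN, hN, hn⟩ := hM.exists_pullback g₁
  have h₁ : (f₀ ≫ a1) ≫ e = (p₀ ≫ k) ≫ g₁ := by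
    rw [Category.assoc, ← he₀, reassoc_of% sq₀.w, hg, Category.assoc]
  have h₂ : (f ≫ a2) ≫ ξ.e₁ = q ≫ g₁ := by rw [Category.assoc, ← he₁, sqN.w]
  refine ⟨N, n, q, sqN.lift _ _ h₁, sq₁.lift _ _ h₂, hN, sq₁.hom_ext ?_ ?_, sqN.hom_ext ?_ ?_,
    (sqN.lift_snd _ _ _).symm, sq₁.hom_ext ?_ ?_, (sq₁.lift_snd _ _ _).symm⟩
  · simp [ha, hf]
  · simp [hp]
  · simp [ArrConf.pullback, hm₀, hn]
  · simp [ArrConf.pullback, reassoc_of% (sq₀.lift_snd ξ.m₀ 0), hN.w]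
  · simp [ArrConf.pullback, reassoc_of% hn, hm₁]
  · simp [ArrConf.pullback, hN.w]

/-- The kernel of the composite `d ⟶ c ⟶ x` of two deflations of arrows is the pullback
of the kernel of `c ⟶ x`. -/
def comp {L₀ L₁ D₀ D₁ C₀ C₁ K₀ K₁ X₀ X₁ W₀ W₁ : A} {l : L₀ ⟶ L₁} {d : D₀ ⟶ D₁} {c : C₀ ⟶ C₁}
    {k : K₀ ⟶ K₁} {x : X₀ ⟶ X₁} {w : W₀ ⟶ W₁} (ξ : ArrConf E k c x) (η : ArrConf E l d c)
    {f₀ : W₀ ⟶ D₀} {f₁ : W₁ ⟶ D₁} {p₀ : W₀ ⟶ K₀} {p₁ : W₁ ⟶ K₁}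
    (sq₀ : IsPullback f₀ p₀ η.e₀ ξ.m₀) (sq₁ : IsPullback f₁ p₁ η.e₁ ξ.m₁)
    (hf : f₀ ≫ d = w ≫ f₁) : ArrConf E w d x where
  m₀ := f₀
  e₀ := η.e₀ ≫ ξ.e₀
  m₁ := f₁
  e₁ := η.e₁ ≫ ξ.e₁
  conf₀ := ξ.conf₀.comp_of_isPullback η.conf₀ sq₀
  conf₁ := ξ.conf₁.comp_of_isPullback η.conf₁ sq₁
  comm_m := hf
  comm_e := by rw [Category.assoc, ξ.comm_e, reassoc_of% η.comm_e]

end ArrConf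

lemma IsObjStar.isStar_id {X Z Y : A} (h : IsObjStar E X Z Y) : IsStar E (𝟙 X) (𝟙 Z) (𝟙 Y) := by
  obtain ⟨m, e, h⟩ := h
  exact ⟨.id h, (ArrConf.id h).isME_of_right_id⟩

end Conflations

section ExtOrth

variable {A : Type u} [Category.{v} A] [Preadditive A] {E : ExactStr A}
  {J₀ J₁ I₀ I₁ : A} {f : J₀ ⟶ J₁} {w : I₀ ⟶ I₁}

lemma exists_isME_of_conf {M : A} {m : I₀ ⟶ M} {e : M ⟶ J₁} (hM : E.conf m e) (f : J₀ ⟶ J₁)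
    (w : I₀ ⟶ I₁) :
    ∃ (P N : A) (b₀ : P ⟶ M) (b : M ⟶ N) (ξ : ArrConf E w (b₀ ≫ b) f), ξ.IsME ∧
      IsPullback b₀ ξ.e₀ e f ∧ ξ.m₀ ≫ b₀ = m ∧ IsPushout m w b ξ.m₁ ∧ b ≫ ξ.e₁ = e := by
  obtain ⟨P, n₀, b₀, q₀, sqP, hP, hn₀⟩ := hM.exists_pullback f
  obtain ⟨N, n, b, q, sqN, hN, hq⟩ := hM.exists_pushout w
  let ξ : ArrConf E w (b₀ ≫ b) f :=
    ⟨n₀, q₀, n, q, hP, hN, by rw [reassoc_of% hn₀, sqN.w], by rw [Category.assoc, hq, sqP.w]⟩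
  exact ⟨P, N, b₀, b, ξ, ⟨M, m, e, b₀, b, hM, rfl, hn₀, sqP.w.symm, sqN.w, hq.symm⟩, sqP, hn₀,
    sqN, hq⟩

lemma ExtOrth.exists_lift (h : ExtOrth E f w) {M R Y : A} {m : I₀ ⟶ M} {e : M ⟶ J₁}
    (hM : E.conf m e) {g : J₁ ⟶ Y} {u : I₁ ⟶ R} {e' : R ⟶ Y} {a : M ⟶ R} (hu : u ≫ e' = 0)
    (hm : m ≫ a = w ≫ u) (he : a ≫ e' = e ≫ g) : ∃ t, t ≫ e' = f ≫ g := by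
  obtain ⟨P, N, b₀, b, ξ, hξ, -, -, sqN, hb⟩ := exists_isME_of_conf hM f w
  obtain ⟨t, ht⟩ := ξ.isNullHomotopic_iff_exists_lift.1 (h _ _ _ ξ hξ)
  have hdesc : sqN.desc a u hm ≫ e' = ξ.e₁ ≫ g := by
    apply sqN.hom_ext
    · rw [sqN.inl_desc_assoc, he, reassoc_of% hb]
    · rw [sqN.inr_desc_assoc, hu, reassoc_of% ξ.conf₁.w, zero_comp]
  exact ⟨t ≫ sqN.desc a u hm, by rw [Category.assoc, hdesc, reassoc_of% ht]⟩

lemma ExtOrth.exists_extension (h : ExtOrth E f w) {M P X : A} {m : I₀ ⟶ M} {e : M ⟶ J₁}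
    (hM : E.conf m e) {g : X ⟶ I₀} {m' : X ⟶ P} {u : P ⟶ J₀} {a : P ⟶ M} (hu : m' ≫ u = 0)
    (hm : m' ≫ a = g ≫ m) (he : a ≫ e = u ≫ f) : ∃ s, m' ≫ s = g ≫ w := by
  obtain ⟨Q, N, b₀, b, ξ, hξ, sqQ, hb₀, -, -⟩ := exists_isME_of_conf hM f w
  obtain ⟨s, hs⟩ := ξ.isNullHomotopic_iff_exists_extension.1 (h _ _ _ ξ hξ)
  have hlift : m' ≫ sqQ.lift a u he = g ≫ ξ.m₀ := by
    apply sqQ.hom_ext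
    · rw [Category.assoc, sqQ.lift_fst, hm, Category.assoc, hb₀]
    · rw [Category.assoc, sqQ.lift_snd, hu, Category.assoc, ξ.conf₀.w, comp_zero]
  exact ⟨sqQ.lift a u he ≫ s, by rw [reassoc_of% hlift, hs]⟩

lemma extOrth_iff_forall_exists_lift :
    ExtOrth E f w ↔ ∀ ⦃M R : A⦄ ⦃m : I₀ ⟶ M⦄ ⦃e : M ⟶ J₁⦄ ⦃m' : I₁ ⟶ R⦄ ⦃e' : R ⟶ J₁⦄ ⦃a : M ⟶ R⦄,
      E.conf m e → E.conf m' e' → m ≫ a = w ≫ m' → a ≫ e' = e → ∃ t, t ≫ e' = f := by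
  refine ⟨fun h M R m e m' e' a hM hR hm he => ?_, fun h A₀ A₁ a ξ hξ => ?_⟩
  · simpa only [Category.comp_id] using
      h.exists_lift hM (g := 𝟙 J₁) hR.w hm (by rw [he, Category.comp_id])
  · obtain ⟨M, m, e, a1, a2, hM, -, -, -, hm, he⟩ := hξ
    exact ξ.isNullHomotopic_iff_exists_lift.2 (h hM ξ.conf₁ hm he.symm)

lemma extOrth_iff_forall_exists_extension :
    ExtOrth E f w ↔ ∀ ⦃M P : A⦄ ⦃m : I₀ ⟶ M⦄ ⦃e : M ⟶ J₁⦄ ⦃m' : I₀ ⟶ P⦄ ⦃e' : P ⟶ J₀⦄ ⦃a : P ⟶ M⦄,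
      E.conf m e → E.conf m' e' → m' ≫ a = m → a ≫ e = e' ≫ f → ∃ s, m' ≫ s = w := by
  refine ⟨fun h M P m e m' e' a hM hP hm he => ?_, fun h A₀ A₁ a ξ hξ => ?_⟩
  · simpa only [Category.id_comp] using
      h.exists_extension hM (g := 𝟙 I₀) hP.w (by rw [hm, Category.id_comp]) he
  · obtain ⟨M, m, e, a1, a2, hM, -, hm, he, -, -⟩ := hξ
    exact ξ.isNullHomotopic_iff_exists_extension.2 (h hM ξ.conf₀ hm he.symm)

lemma ExtOrth.precomp_left (h : ExtOrth E f w) {T : A} (g : T ⟶ J₀) : ExtOrth E (g ≫ f) w := by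
  rw [extOrth_iff_forall_exists_lift] at h ⊢
  intro M R m e m' e' a hM hR hm he
  obtain ⟨t, ht⟩ := h hM hR hm he
  exact ⟨g ≫ t, by rw [Category.assoc, ht]⟩

lemma ExtOrth.comp_left (h : ExtOrth E f w) {T : A} (g : J₁ ⟶ T) : ExtOrth E (f ≫ g) w := by
  rw [extOrth_iff_forall_exists_lift]
  intro M R m e m' e' a hM hR hm he
  obtain ⟨N, n, b, q, sq, hN, hn⟩ := hM.exists_pullback g
  exact h.exists_lift hN (a := b ≫ a) hR.w (by rw [reassoc_of% hn, hm])
    (by rw [Category.assoc, he, sq.w])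

lemma ExtOrth.comp_right (h : ExtOrth E f w) {T : A} (g : I₁ ⟶ T) : ExtOrth E f (w ≫ g) := by
  rw [extOrth_iff_forall_exists_extension] at h ⊢
  intro M P m e m' e' a hM hP hm he
  obtain ⟨s, hs⟩ := h hM hP hm he
  exact ⟨s ≫ g, by rw [reassoc_of% hs]⟩

lemma ExtOrth.precomp_right (h : ExtOrth E f w) {T : A} (g : T ⟶ I₀) : ExtOrth E f (g ≫ w) := by
  rw [extOrth_iff_forall_exists_extension]
  intro M P m e m' e' a hM hP hm he
  obtain ⟨N, n, b, q, sq, hN, hq⟩ := hM.exists_pushout g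
  exact h.exists_extension hN (a := a ≫ b) hP.w (by rw [reassoc_of% hm, sq.w])
    (by rw [Category.assoc, hq, he])

variable (E) in
/-- The ideal of the morphisms `f` with `Ext (f, w) = 0`, for a fixed morphism `w`. -/
def leftOrthIdeal (w : I₀ ⟶ I₁) : MorIdeal A where
  hom X Y :=
    { carrier := {f | ExtOrth E f w}
      add_mem' := fun {f f'} hf hf' => by
        rw [Set.mem_ofPred_eq, extOrth_iff_forall_exists_lift] at *
        intro M R m e m' e' a hM hR hm he
        obtain ⟨t, rfl⟩ := hf hM hR hm he
        obtain ⟨t', rfl⟩ := hf' hM hR hm he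
        exact ⟨t + t', Preadditive.add_comp ..⟩
      zero_mem' := extOrth_iff_forall_exists_lift.2 fun _ _ _ _ _ _ _ _ _ _ _ => ⟨0, zero_comp⟩
      neg_mem' := fun {f} hf => by
        rw [Set.mem_ofPred_eq, extOrth_iff_forall_exists_lift] at *
        intro M R m e m' e' a hM hR hm he
        obtain ⟨t, rfl⟩ := hf hM hR hm he
        exact ⟨-t, Preadditive.neg_comp ..⟩ }
  comp_mem h _ f hg := (ExtOrth.comp_left hg f).precomp_left h

variable (E) in
/-- The ideal of the morphisms `w` with `Ext (f, w) = 0`, for a fixed morphism `f`. -/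
def rightOrthIdeal (f : J₀ ⟶ J₁) : MorIdeal A where
  hom X Y :=
    { carrier := {w | ExtOrth E f w}
      add_mem' := fun {w w'} hw hw' => by
        rw [Set.mem_ofPred_eq, extOrth_iff_forall_exists_extension] at *
        intro M P m e m' e' a hM hP hm he
        obtain ⟨s, rfl⟩ := hw hM hP hm he
        obtain ⟨s', rfl⟩ := hw' hM hP hm he
        exact ⟨s + s', Preadditive.comp_add ..⟩
      zero_mem' :=
        extOrth_iff_forall_exists_extension.2 fun _ _ _ _ _ _ _ _ _ _ _ => ⟨0, comp_zero⟩
      neg_mem' := fun {w} hw => by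
        rw [Set.mem_ofPred_eq, extOrth_iff_forall_exists_extension] at *
        intro M P m e m' e' a hM hP hm he
        obtain ⟨s, rfl⟩ := hw hM hP hm he
        exact ⟨-s, Preadditive.comp_neg ..⟩ }
  comp_mem h _ g hw := (ExtOrth.comp_right hw g).precomp_right h

variable (E) in
/-- The right perpendicular `I^⊥`, as an ideal. -/
def rightPerpIdeal (I : MorIdeal A) : MorIdeal A where
  hom X Y :=
    { carrier := {k | rightPerp E I k}
      add_mem' := fun hk hk' _ _ i hi =>
        ((rightOrthIdeal E i).hom X Y).add_mem (hk _ _ i hi) (hk' _ _ i hi)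
      zero_mem' := fun _ _ i _ => ((rightOrthIdeal E i).hom X Y).zero_mem
      neg_mem' := fun hk _ _ i hi => ((rightOrthIdeal E i).hom X Y).neg_mem (hk _ _ i hi) }
  comp_mem h k g hk _ _ i hi := (rightOrthIdeal E i).comp_mem h k g (hk _ _ i hi)

lemma objIdeal_le_rightPerp_iff {I : MorIdeal A} {P : ObjectProperty A} :
    (objIdeal P).mor ≤ rightPerp E I ↔ ∀ X, P X → rightPerp E I (𝟙 X) :=
  MorIdeal.objIdeal_le_iff (I := rightPerpIdeal E I)

lemma ExtOrth.comp_of_isStar {X Y Z K₀ K₁ L₀ L₁ W₀ W₁ : A} {j : X ⟶ Z} {i : Z ⟶ Y}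
    {l : L₀ ⟶ L₁} {w : W₀ ⟶ W₁} {k : K₀ ⟶ K₁} (hi : ExtOrth E i k) (hj : ExtOrth E j l)
    (hw : IsStar E l w k) : ExtOrth E (j ≫ i) w := by
  obtain ⟨ξ, N, n, q, a1, a2, hN, rfl, -, hq, hn, -⟩ := hw
  rw [extOrth_iff_forall_exists_lift]
  intro M R m e m' e' a hM hR hm he
  obtain ⟨B, mB, b, eB, sqB, hB, hb⟩ := hM.exists_pushout a1
  obtain ⟨P, mP, p, eP, sqP, hP, hp⟩ := hB.exists_pushout q
  -- `P` is the pushout of `M` along `ξ.e₀ ≫ k`, so `i` lifts to `P`.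
  obtain ⟨s, hs⟩ : ∃ s, s ≫ eP = i :=
    extOrth_iff_forall_exists_lift.1 (hi.precomp_right ξ.e₀) hM hP
      (show m ≫ b ≫ p = (ξ.e₀ ≫ k) ≫ mP by
        rw [reassoc_of% sqB.w, sqP.w, hq, Category.assoc])
      (show (b ≫ p) ≫ eP = e by rw [Category.assoc, hp, hb])
  -- Pulling `L₀ ⟶ B ⟶ P` back along `s` gives the class of `Ext (Z, L₀)` that maps to `B` over `i`.
  obtain ⟨B', n', c, q', sqB', hB', hc⟩ := (hN.comp_of_isPushout hB sqP).exists_pullback s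
  have hr : m ≫ a = a1 ≫ a2 ≫ m' := by rw [hm, Category.assoc]
  have hre : sqB.desc a (a2 ≫ m') hr ≫ e' = eB := by
    apply sqB.hom_ext
    · rw [sqB.inl_desc_assoc, he, hb]
    · rw [sqB.inr_desc_assoc, Category.assoc, hR.w, comp_zero, hB.w]
  refine hj.exists_lift hB' (a := c ≫ sqB.desc a (a2 ≫ m') hr) (u := ξ.m₁ ≫ m') ?_ ?_ ?_
  · rw [Category.assoc, hR.w, comp_zero]
  · rw [reassoc_of% hc, sqB.inr_desc, reassoc_of% hn]
  · rw [Category.assoc, hre, ← hp, reassoc_of% sqB'.w, hs]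

lemma rightPerp_prod_of_isStar {I J : MorIdeal A} {K₀ K₁ L₀ L₁ W₀ W₁ : A} {l : L₀ ⟶ L₁}
    {w : W₀ ⟶ W₁} {k : K₀ ⟶ K₁} (hk : rightPerp E I k) (hl : rightPerp E J l)
    (hw : IsStar E l w k) : rightPerp E (I.prod J) w := by
  have hgen : I.composites J ≤ (leftOrthIdeal E w).mor := by
    rintro _ _ _ ⟨_, j, i, hj, hi, rfl⟩
    exact (hk _ _ i hi).comp_of_isStar (hl _ _ j hj) hw
  exact fun _ _ f hf => MorIdeal.span_le_iff.2 hgen f hf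

end ExtOrth

section ChainRule

variable {A : Type u} [Category.{v} A] [Preadditive A] {E : ExactStr A} {I J : MorIdeal A}

lemma IsSpecialPrecoverWith.comp {X C D : A} {i : C ⟶ X} {j : D ⟶ C} {K₀ K₁ L₀ L₁ : A}
    {k : K₀ ⟶ K₁} {l : L₀ ⟶ L₁} (hi : IsSpecialPrecoverWith E I i k)
    (hj : IsSpecialPrecoverWith E J j l) :
    ∃ (W₀ W₁ : A) (w : W₀ ⟶ W₁),
      IsSpecialPrecoverWith E (I.prod J) (j ≫ i) w ∧ IsStar E l w k := by
  obtain ⟨hiI, hk, C₀, c, ξ, rfl⟩ := hi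
  obtain ⟨hjJ, hl, D₀, d, η, rfl⟩ := hj
  obtain ⟨D', -, f, p, sq, -⟩ := η.conf₀.exists_pullback c
  have hp : p ≫ c = (f ≫ d) ≫ η.e₁ := by rw [Category.assoc, ← η.comm_e, Category.comp_id, sq.w]
  let δ : ArrConf E l (f ≫ d) c :=
    η.pullback sq (.id_horiz η.e₁) (Category.comp_id _).symm hp
  have hδ : δ.IsME := η.isME_of_right_id.pullback sq _ rfl _ hp
  obtain ⟨W₀, -, f₀, p₀, sq₀, -⟩ := δ.conf₀.exists_pullback ξ.m₀
  obtain ⟨W₁, -, f₁, p₁, sq₁, -⟩ := δ.conf₁.exists_pullback ξ.m₁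
  obtain ⟨w, hwf, hwp⟩ : ∃ w : W₀ ⟶ W₁, w ≫ f₁ = f₀ ≫ f ≫ d ∧ w ≫ p₁ = p₀ ≫ k :=
    sq₁.exists_lift _ _ (by
      rw [Category.assoc, ← δ.comm_e, reassoc_of% sq₀.w, ξ.comm_m, Category.assoc])
  have hstar : IsStar E l w k :=
    ⟨δ.pullback sq₀ sq₁ hwf.symm hwp.symm, hδ.pullback sq₀ sq₁ ξ.comm_m _ _⟩
  exact ⟨W₀, W₁, w, ⟨MorIdeal.comp_mem_prod hjJ hiI, rightPerp_prod_of_isStar hk hl hstar,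
    D', f ≫ d, ξ.comp δ sq₀ sq₁ hwf.symm, rfl⟩, hstar⟩

lemma IsSpecialPrecoverWith.of_conf {C X K : A} {m : K ⟶ C} {i : C ⟶ X} (h : E.conf m i)
    (hi : I.mor i) (hK : rightPerp E I (𝟙 K)) : IsSpecialPrecoverWith E I i (𝟙 K) :=
  ⟨hi, hK, C, 𝟙 C, .id h, rfl⟩

lemma isObjSpecialPrecoverWith_iff {C X K : A} {i : C ⟶ X} :
    IsObjSpecialPrecoverWith E I i K ↔
      I.mor i ∧ rightPerp E I (𝟙 K) ∧ ∃ m : K ⟶ C, E.conf m i := by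
  constructor
  · rintro ⟨⟨K₀, K₁, k, _, hi, hk, C₀, c, ξ, rfl⟩, m, hm⟩
    obtain ⟨p, hp⟩ := hm.exists_lift _ ξ.conf₁.w
    obtain ⟨q, hq⟩ := ξ.conf₁.exists_lift _ hm.w
    have := hm.mono
    have hfac : (q ≫ inv k) ≫ k ≫ p = 𝟙 K := by
      rw [← cancel_mono m]
      simp [hp, hq]
    exact ⟨hi, hfac ▸ (rightPerpIdeal E I).comp_mem (q ≫ inv k) k p hk, m, hm⟩
  · rintro ⟨hi, hK, m, hm⟩
    exact ⟨⟨K, K, 𝟙 K, inferInstance, .of_conf hm hi hK⟩, m, hm⟩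

lemma IsObjSpecialPrecover.exists_kernel {C X : A} {i : C ⟶ X} (h : IsObjSpecialPrecover E I i) :
    ∃ K, IsObjSpecialPrecoverWith E I i K := by
  obtain ⟨_, K₁, _, _, _, _, _, _, ξ, rfl⟩ := id h
  exact ⟨K₁, h, ξ.m₁, ξ.conf₁⟩

lemma IsObjSpecialPrecoverWith.comp {X C D K L : A} {i : C ⟶ X} {j : D ⟶ C}
    (hi : IsObjSpecialPrecoverWith E I i K) (hj : IsObjSpecialPrecoverWith E J j L) :
    ∃ W : A, IsObjSpecialPrecoverWith E (I.prod J) (j ≫ i) W ∧ IsObjStar E L W K := by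
  obtain ⟨hi, hK, m, hm⟩ := isObjSpecialPrecoverWith_iff.1 hi
  obtain ⟨hj, hL, n, hn⟩ := isObjSpecialPrecoverWith_iff.1 hj
  obtain ⟨W, s, f, p, sq, hW, -⟩ := hn.exists_pullback m
  have hstar : IsObjStar E L W K := ⟨s, p, hW⟩
  exact ⟨W, isObjSpecialPrecoverWith_iff.2 ⟨MorIdeal.comp_mem_prod hj hi,
    rightPerp_prod_of_isStar hK hL hstar.isStar_id, f, hm.comp_of_isPullback hn sq⟩, hstar⟩

lemma IsSpecialPrecoverWith.exists_obj_of_factor {X C K₀ K₁ U : A} {i : C ⟶ X} {a : K₀ ⟶ U}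
    {b : U ⟶ K₁} (h : IsSpecialPrecoverWith E I i (a ≫ b)) (hU : rightPerp E I (𝟙 U)) :
    ∃ (C' : A) (i' : C' ⟶ X), IsObjSpecialPrecoverWith E I i' U := by
  obtain ⟨hi, -, C₀, c, ξ, rfl⟩ := h
  obtain ⟨C', m', f', e', sq, hC', he'⟩ := ξ.conf₀.exists_pushout a
  have hc : ξ.m₀ ≫ c = a ≫ b ≫ ξ.m₁ := by rw [ξ.comm_m, Category.assoc]
  have hfac : sq.desc c (b ≫ ξ.m₁) hc ≫ ξ.e₁ = e' := by
    apply sq.hom_ext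
    · rw [sq.inl_desc_assoc, he', ← ξ.comm_e, Category.comp_id]
    · rw [sq.inr_desc_assoc, Category.assoc, ξ.conf₁.w, comp_zero, hC'.w]
  exact ⟨C', e', isObjSpecialPrecoverWith_iff.2 ⟨hfac ▸ MorIdeal.precomp _ hi, hU, m', hC'⟩⟩

lemma IsSpecialPrecovering.prod (hI : IsSpecialPrecovering E I) (hJ : IsSpecialPrecovering E J) :
    IsSpecialPrecovering E (I.prod J) := fun X => by
  obtain ⟨C, i, _, _, k, hi⟩ := hI X
  obtain ⟨D, j, _, _, l, hj⟩ := hJ C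
  obtain ⟨W₀, W₁, w, h, -⟩ := hi.comp hj
  exact ⟨D, j ≫ i, W₀, W₁, w, h⟩

lemma IsObjSpecialPrecovering.prod (hI : IsObjSpecialPrecovering E I)
    (hJ : IsObjSpecialPrecovering E J) : IsObjSpecialPrecovering E (I.prod J) := fun X => by
  obtain ⟨C, i, hi⟩ := hI X
  obtain ⟨D, j, hj⟩ := hJ C
  obtain ⟨K, hi⟩ := hi.exists_kernel
  obtain ⟨L, hj⟩ := hj.exists_kernel
  obtain ⟨W, h, -⟩ := hi.comp hj
  exact ⟨D, j ≫ i, h.1⟩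

lemma IsSyzygyIdeal.diamond {wI wJ : MorIdeal A} (hI : IsSyzygyIdeal E I wI)
    (hJ : IsSyzygyIdeal E J wJ) : IsSyzygyIdeal E (I.prod J) (diamond E wJ wI) := by
  refine ⟨MorIdeal.span_le_iff (I := rightPerpIdeal E (I.prod J)).2 ?_, fun X => ?_⟩
  · rintro _ _ w ⟨_, _, _, _, l, k, hl, hk, hw⟩
    exact rightPerp_prod_of_isStar (hI.1 _ hk) (hJ.1 _ hl) hw
  · obtain ⟨C, i, _, _, k, hi, hk⟩ := hI.2 X
    obtain ⟨D, j, _, _, l, hj, hl⟩ := hJ.2 C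
    obtain ⟨W₀, W₁, w, h, hw⟩ := hi.comp hj
    exact ⟨D, j ≫ i, W₀, W₁, w, h, MorIdeal.le_span _ _ ⟨_, _, _, _, l, k, hl, hk, hw⟩⟩

end ChainRule

section Biproducts

variable {A : Type u} [Category.{v} A] [Preadditive A] {E : ExactStr A}

namespace ExactStr

variable [HasBinaryBiproducts A] {X Y Z : A} {m : X ⟶ Y} {e : Y ⟶ Z}

lemma conf.biprod_map_id (h : E.conf m e) (X' : A) :
    E.conf (biprod.map m (𝟙 X')) (biprod.fst ≫ e) := by
  refine h.of_isPushout (f := biprod.inl) (f' := biprod.inl)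
    ⟨⟨by simp⟩, ⟨PushoutCocone.IsColimit.mk _
      (fun s => biprod.desc s.inl (biprod.inr ≫ s.inr)) (fun s => by simp) (fun s => ?_)
      fun s t h₁ h₂ => ?_⟩⟩ (by simp) ?_
  · have := s.condition
    ext <;> simp [this]
  · ext
    · simpa using h₁
    · simp [← h₂]
  · simp [h.w]

lemma conf.biprod_id_map (h : E.conf m e) (X' : A) :
    E.conf (biprod.map (𝟙 X') m) (biprod.snd ≫ e) :=
  E.of_iso (biprod.braiding _ _) (biprod.braiding _ _) (Iso.refl _) (by ext <;> simp) (by simp)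
    (h.biprod_map_id X')

lemma conf.biprod_map (h : E.conf m e) {X' Y' Z' : A} {m' : X' ⟶ Y'} {e' : Y' ⟶ Z'}
    (h' : E.conf m' e') : E.conf (biprod.map m m') (biprod.map e e') := by
  obtain ⟨B, g, hB⟩ := E.inflation_comp (h.biprod_map_id X') (h'.biprod_id_map Y)
  have hmm : biprod.map m (𝟙 X') ≫ biprod.map (𝟙 Y) m' = biprod.map m m' := by ext <;> simp
  rw [hmm] at hB
  have := h.epi
  have := h'.epi
  refine hB.of_cokernel _ (by ext <;> simp [h.w, h'.w]) fun f hf => ?_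
  obtain ⟨s, hs⟩ := h.exists_desc (biprod.inl ≫ f) (by simpa using biprod.inl ≫= hf)
  obtain ⟨t, ht⟩ := h'.exists_desc (biprod.inr ≫ f) (by simpa using biprod.inr ≫= hf)
  exact ⟨biprod.desc s t, by ext <;> simp [hs, ht]⟩

end ExactStr

variable [HasFiniteBiproducts A]

attribute [local instance] hasBinaryBiproducts_of_finite_biproducts

/-- The ideal of the morphisms that factor through an object of `P`. -/
def factorIdeal (P : ObjectProperty A) [P.IsClosedUnderFiniteProducts] : MorIdeal A where
  hom X Y :=
    { carrier := {f | ∃ (U : A) (a : X ⟶ U) (b : U ⟶ Y), P U ∧ a ≫ b = f}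
      add_mem' := by
        rintro _ _ ⟨U, a, b, hU, rfl⟩ ⟨V, c, d, hV, rfl⟩
        exact ⟨U ⊞ V, biprod.lift a c, biprod.desc b d,
          P.prop_of_isLimit_binaryFan (BinaryBiproduct.isLimit U V) hU hV, by simp⟩
      zero_mem' := ⟨⊤_ A, 0, 0, P.prop_terminal, zero_comp⟩
      neg_mem' := by
        rintro _ ⟨U, a, b, hU, rfl⟩
        exact ⟨U, -a, b, hU, Preadditive.neg_comp _ _⟩ }
  comp_mem := by
    rintro _ _ _ _ h _ f ⟨U, a, b, hU, rfl⟩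
    exact ⟨U, h ≫ a, b ≫ f, hU, by simp⟩

lemma exists_factor_of_mem_objIdeal {P : ObjectProperty A} [P.IsClosedUnderFiniteProducts]
    {X Y : A} {f : X ⟶ Y} (hf : (objIdeal P).mor f) :
    ∃ (U : A) (a : X ⟶ U) (b : U ⟶ Y), P U ∧ a ≫ b = f :=
  MorIdeal.objIdeal_le_iff (I := factorIdeal P).2
    (fun X hX => ⟨X, 𝟙 X, 𝟙 X, hX, Category.comp_id _⟩) _ hf

lemma isClosedUnderFiniteProducts_of_biprod {P : ObjectProperty A} [P.IsClosedUnderIsomorphisms]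
    [P.ContainsZero] (hP : ∀ X Y, P X → P Y → P (X ⊞ Y)) : P.IsClosedUnderFiniteProducts := by
  have : P.IsClosedUnderBinaryProducts := .mk' (by
    rintro _ ⟨F, hF⟩
    exact P.prop_of_iso
      (biprod.isoProd _ _ ≪≫ (HasLimit.isoOfNatIso (diagramIsoPair F)).symm)
      (hP _ _ (hF ⟨.left⟩) (hF ⟨.right⟩)))
  exact .mk'

lemma isClosedUnderFiniteProducts_starObj (P Q : ObjectProperty A)
    [P.IsClosedUnderFiniteProducts] [Q.IsClosedUnderFiniteProducts] :
    (starObj E P Q).IsClosedUnderFiniteProducts := by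
  have : (starObj E P Q).IsClosedUnderIsomorphisms := ⟨by
    rintro Z Z' φ ⟨X, Y, hX, hY, m, e, h⟩
    exact ⟨X, Y, hX, hY, m ≫ φ.hom, φ.inv ≫ e,
      E.of_iso (Iso.refl _) φ (Iso.refl _) (by simp) (by simp) h⟩⟩
  have hT : IsZero (⊤_ A) :=
    (isZero_zero A).of_iso (terminalIsTerminal.uniqueUpToIso (isZero_zero A).isTerminal)
  have : (starObj E P Q).ContainsZero :=
    ⟨⊤_ A, hT, ⊤_ A, ⊤_ A, P.prop_terminal, Q.prop_terminal, 𝟙 _, 0, E.conf_id_zero _ hT⟩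
  refine isClosedUnderFiniteProducts_of_biprod ?_
  rintro _ _ ⟨X, Y, hX, hY, m, e, h⟩ ⟨X', Y', hX', hY', m', e', h'⟩
  exact ⟨X ⊞ X', Y ⊞ Y', P.prop_of_isLimit_binaryFan (BinaryBiproduct.isLimit _ _) hX hX',
    Q.prop_of_isLimit_binaryFan (BinaryBiproduct.isLimit _ _) hY hY', _, _, h.biprod_map h'⟩

variable {I J : MorIdeal A} {P Q : ObjectProperty A}

lemma IsSyzygySubcat.exists_isObjSpecialPrecoverWith (hP : IsSyzygySubcat E I P) (X : A) :
    ∃ (C : A) (i : C ⟶ X) (U : A), P U ∧ IsObjSpecialPrecoverWith E I i U := by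
  have := hP.1
  obtain ⟨C, i, K₀, K₁, k, hi, hk⟩ := hP.2.2 X
  obtain ⟨U, a, b, hU, rfl⟩ := exists_factor_of_mem_objIdeal hk
  obtain ⟨C', i', h⟩ := hi.exists_obj_of_factor (objIdeal_le_rightPerp_iff.1 hP.2.1 U hU)
  exact ⟨C', i', U, hU, h⟩

lemma IsSyzygySubcat.starObj (hP : IsSyzygySubcat E I P) (hQ : IsSyzygySubcat E J Q) :
    IsSyzygySubcat E (I.prod J) (starObj E Q P) := by
  have := hP.1
  have := hQ.1
  refine ⟨isClosedUnderFiniteProducts_starObj Q P, objIdeal_le_rightPerp_iff.2 ?_, fun X => ?_⟩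
  · rintro Z ⟨V, U, hV, hU, hZ⟩
    exact rightPerp_prod_of_isStar (objIdeal_le_rightPerp_iff.1 hP.2.1 U hU)
      (objIdeal_le_rightPerp_iff.1 hQ.2.1 V hV) hZ.isStar_id
  · obtain ⟨C, i, U, hU, hi⟩ := hP.exists_isObjSpecialPrecoverWith X
    obtain ⟨D, j, V, hV, hj⟩ := hQ.exists_isObjSpecialPrecoverWith C
    obtain ⟨W, hji, hW⟩ := hi.comp hj
    obtain ⟨hmem, hperp, m, hm⟩ := isObjSpecialPrecoverWith_iff.1 hji
    exact ⟨D, j ≫ i, W, W, 𝟙 W, .of_conf hm hmem hperp,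
      MorIdeal.le_span _ _ ⟨⟨V, U, hV, hU, hW⟩, rfl, rfl⟩⟩

end Biproducts

end IdealApprox

open IdealApprox in
theorem mainTheorem9 {A : Type u} [Category.{v} A] [Preadditive A] [HasFiniteBiproducts A]
    (E : ExactStr A) (I J : MorIdeal A) :
    -- chain rule for syzygies
    (∀ {X C D : A} (i : C ⟶ X) (j : D ⟶ C) {K₀ K₁ L₀ L₁ : A} (k : K₀ ⟶ K₁) (l : L₀ ⟶ L₁),
      IsSpecialPrecoverWith E I i k → IsSpecialPrecoverWith E J j l →
        ∃ (W₀ W₁ : A) (w : W₀ ⟶ W₁),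
          IsSpecialPrecoverWith E (I.prod J) (j ≫ i) w ∧ IsStar E l w k) ∧
    -- chain rule for object syzygies
    (∀ {X C D : A} (i : C ⟶ X) (j : D ⟶ C) (K L : A),
      IsObjSpecialPrecoverWith E I i K → IsObjSpecialPrecoverWith E J j L →
        ∃ W : A, IsObjSpecialPrecoverWith E (I.prod J) (j ≫ i) W ∧ IsObjStar E L W K) ∧
    -- products of special precovering ideals
    (IsSpecialPrecovering E I → IsSpecialPrecovering E J →
      IsSpecialPrecovering E (I.prod J) ∧
      ∀ wI wJ : MorIdeal A, IsSyzygyIdeal E I wI → IsSyzygyIdeal E J wJ →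
        IsSyzygyIdeal E (I.prod J) (diamond E wJ wI)) ∧
    -- products of object-special precovering ideals
    (IsObjSpecialPrecovering E I → IsObjSpecialPrecovering E J →
      IsObjSpecialPrecovering E (I.prod J) ∧
      ∀ ΩI ΩJ : ObjectProperty A, IsSyzygySubcat E I ΩI → IsSyzygySubcat E J ΩJ →
        IsSyzygySubcat E (I.prod J) (starObj E ΩJ ΩI)) := by
  exact ⟨fun _ _ _ _ _ _ _ _ hi hj => hi.comp hj, fun _ _ _ _ hi hj => hi.comp hj,
    fun hI hJ => ⟨hI.prod hJ, fun _ _ hwI hwJ => hwI.diamond hwJ⟩,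
    fun hI hJ => ⟨hI.prod hJ, fun _ _ hΩI hΩJ => hΩI.starObj hΩJ⟩⟩
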